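/- Let $T$ and $K$ be finite sets and write $\mathbb{R}^K_+$ for the nonnegative orthant. For each $t\in T$ let $m^t$ be an income, $\overline{\mathbf p}^t\in\mathbb{R}^K_{++}$ a price vector, $\mathscr{E}^t=\{\mathbf e\in\mathbb{R}^K_+:\sum_{k\in K}e_k=m^t\}$, and $\mu^t$ a (Borel) probability distribution on $\mathscr{E}^t$. For $\mathbf e\in\mathbb{R}^K_+$ and $\mathbf p\in\mathbb{R}^K_{++}$ let $\mathbf x(\mathbf e,\mathbf p)=(e_k/p_k)_{k\in K}$. Let $\mathscr{U}$ be the set of all strictly increasing, strictly concave, continuous functions $u:\mathbb{R}^K_+\to\mathbb{R}$, with the $\sigma$-algebra generated by the evaluations $u\mapsto u(\mathbf x)$. The data set $\{(\mu^t,\overline{\mathbf p}^t)\}_{t\in T}$ is *RUM-rationalizable* if there is a probability distribution $\rho$ on $\mathscr{U}$ such that, for all $t\in T$ and all measurable $E\subseteq\mathbb{R}^K_+$, $$\mu^t(E)=\rho\Big(\Big\{u\in\mathscr{U}:\arg\max_{\mathbf e\in\mathscr{E}^t}u(\mathbf x(\mathbf e,\overline{\mathbf p}^t))\in E\Big\}\Big).$$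 For $R\subseteq K$, it is *RPM-rationalizable* if there are a probability distribution $\eta$ on $\mathbb{R}_{++}$ and a utility function $u\in\mathscr{U}$ such that, for all $t\in T$ and all measurable $E\subseteq\mathbb{R}^K_+$, $$\mu^t(E)=\eta\Big(\Big\{\lambda\in\mathbb{R}_{++}:\arg\max_{\mathbf e\in\mathscr{E}^t}u(\mathbf x(\mathbf e,\mathbf p^{\lambda,t}))\in E\Big\}\Big),\qquad \mathbf p^{\lambda,t}=(\lambda\,\overline{\mathbf p}^t_R,\overline{\mathbf p}^t_{-R});$$ it is *RPM-rationalizable with consistency in expectation* if moreover $\eta$ can be chosen with $\int\lambda\,d\eta(\lambda)=1$. Let $d_{LP}$ be the Lévy–Prokhorov metric for the Euclidean norm on $\mathbb{R}^K$. **Proposition.** Let $R\subseteq K$ and suppose that for every $t\in T$, $\mu^t$-almost every $\mathbf e\in\mathscr{E}^t$ satisfies $e_k>0$ for at least one $k\in R$. 1. If $\{(\mu^t,\overline{\mathbf p}^t)\}_{t\in T}$ is RPM-rationalizable, then it is RUM-rationalizable. 2. If $\{(\mu^t,\overline{\mathbf p}^t)\}_{t\in T}$ is RUM-rationalizable, then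 for every $\varepsilon>0$ there are finitely supported probability distributions $\hat\mu^t$ on $\mathscr{E}^t$ such that $d_{LP}(\mu^t,\hat\mu^t)<\varepsilon$ for all $t\in T$ and $\{(\hat\mu^t,\overline{\mathbf p}^t)\}_{t\in T}$ is RPM-rationalizable with consistency in expectation. 3. If $\{(\mu^t,\overline{\mathbf p}^t)\}_{t\in T}$ is RUM-rationalizable and every $\mu^t$ is discrete (concentrated on a countable set), then $\{(\mu^t,\overline{\mathbf p}^t)\}_{t\in T}$ is itself RPM-rationalizable with consistency in expectation. -/

import Mathlib

open MeasureTheory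
open scoped NNReal ENNReal

/-- `u : ℝ^K_+ → ℝ` is strictly increasing, strictly concave and continuous. -/
structure IsUtility {K : Type*} (u : (K → ℝ≥0) → ℝ) : Prop where
  strictMono : StrictMono u
  strictConcave : StrictConcaveOn ℝ≥0 Set.univ u
  continuous : Continuous u

/-- The set `𝒰` of utility functions. As a subtype of a space of functions it carries the
σ-algebra generated by the evaluations `u ↦ u x`; on continuous functions this is the Borel
σ-algebra of locally uniform convergence. -/
abbrev Utility (K : Type*) : Type _ := {u : (K → ℝ≥0) → ℝ // IsUtility u}

/-- The consumption bundle `x(e, p) = (e_k / p_k)_k`. -/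
noncomputable def bundle {K : Type*} (e p : K → ℝ≥0) : K → ℝ≥0 := fun k => e k / p k

/-- The expenditure allocations `{e ∈ ℝ^K_+ : ∑ e_k = m}` at income `m`. -/
def allocations {K : Type*} [Fintype K] (m : ℝ≥0) : Set (K → ℝ≥0) := {e | ∑ k, e k = m}

/-- `e` maximizes `u (x(e', p))` over the allocations `e'` at income `m`. -/
def IsOptimal {K : Type*} [Fintype K] (u : (K → ℝ≥0) → ℝ) (m : ℝ≥0) (p e : K → ℝ≥0) : Prop :=
  e ∈ allocations m ∧ ∀ e' ∈ allocations m, u (bundle e' p) ≤ u (bundle e p)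

lemma isCompact_allocations {K : Type*} [Fintype K] (m : ℝ≥0) :
    IsCompact (allocations m : Set (K → ℝ≥0)) := by
  have hc : IsClosed (allocations m : Set (K → ℝ≥0)) :=
    isClosed_eq (by fun_prop) continuous_const
  refine (isCompact_univ_pi (fun _ : K => isCompact_Icc (a := (0 : ℝ≥0)) (b := m))).of_isClosed_subset
    hc ?_
  intro e he k _
  refine ⟨zero_le, ?_⟩
  have he' : ∑ k, e k = m := he
  rw [← he']
  exact Finset.single_le_sum (f := e) (fun _ _ => zero_le) (Finset.mem_univ k)

/-- The optimal allocation exists and is unique, so that "the argmax lies in `E`" is the same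
as "some optimal allocation lies in `E`". -/
theorem existsUnique_isOptimal {K : Type*} [Fintype K] [Nonempty K] {u : (K → ℝ≥0) → ℝ}
    (hu : IsUtility u) (m : ℝ≥0) {p : K → ℝ≥0} (hp : ∀ k, 0 < p k) :
    ∃! e, IsOptimal u m p e := by
  classical
  have hne : (allocations m : Set (K → ℝ≥0)).Nonempty := by
    refine ⟨Pi.single (Classical.arbitrary K) m, ?_⟩
    simp [allocations]
  have hcont : Continuous fun e : K → ℝ≥0 => u (bundle e p) := by
    refine hu.continuous.comp (continuous_pi fun k => ?_)
    unfold bundle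
    exact (continuous_apply k).div_const _
  obtain ⟨e, he, hmax⟩ := (isCompact_allocations m).exists_isMaxOn hne hcont.continuousOn
  refine ⟨e, ⟨he, fun e' he' => hmax he'⟩, ?_⟩
  rintro e' ⟨he', hmax'⟩
  by_contra hne'
  have hb : bundle e' p ≠ bundle e p := by
    intro h
    apply hne'
    funext k
    have := congrFun h k
    simp only [bundle] at this
    exact (div_left_inj' (hp k).ne').1 this
  have hhalf : (0 : ℝ≥0) < 1 / 2 := by norm_num
  have hsum : (1 / 2 : ℝ≥0) + 1 / 2 = 1 := add_halves 1
  have hs := hu.strictConcave.2 (Set.mem_univ _) (Set.mem_univ _) hb hhalf hhalf hsum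
  have hmid : ((1 / 2 : ℝ≥0) • e' + (1 / 2 : ℝ≥0) • e) ∈ (allocations m : Set (K → ℝ≥0)) := by
    have h1 : ∑ k, e' k = m := he'
    have h2 : ∑ k, e k = m := he
    simp only [allocations, Set.mem_ofPred_eq, Pi.add_apply, Pi.smul_apply, smul_eq_mul,
      Finset.sum_add_distrib, ← Finset.mul_sum, h1, h2]
    rw [← add_mul, hsum, one_mul]
  have hbm : bundle ((1 / 2 : ℝ≥0) • e' + (1 / 2 : ℝ≥0) • e) p
      = (1 / 2 : ℝ≥0) • bundle e' p + (1 / 2 : ℝ≥0) • bundle e p := by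
    funext k
    simp only [bundle, Pi.add_apply, Pi.smul_apply, smul_eq_mul, add_div, mul_div_assoc]
  have h3 : u (bundle ((1 / 2 : ℝ≥0) • e' + (1 / 2 : ℝ≥0) • e) p) ≤ u (bundle e p) := hmax hmid
  have h4 : u (bundle e p) ≤ u (bundle e' p) := hmax' e he
  have h5 : u (bundle e' p) ≤ u (bundle e p) := hmax he'
  rw [hbm] at h3
  have h6 : u (bundle e' p) = u (bundle e p) := le_antisymm h5 h4
  rw [h6, Convex.combo_self hsum] at hs
  exact absurd (hs.trans_le h3) (lt_irrefl _)

/-- The prices `p^λ = (λ p_R, p_{-R})`. -/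
def scalePrice {K : Type*} [DecidableEq K] (R : Finset K) (l : ℝ≥0) (p : K → ℝ≥0) : K → ℝ≥0 :=
  fun k => if k ∈ R then l * p k else p k

/-- The data set with incomes `m t`, prices `p t` and distributions `μ t` of expenditure
allocations arises from a random utility at the prices `p t`. -/
def RUMRationalizable {T K : Type*} [Fintype K] (m : T → ℝ≥0) (p : T → K → ℝ≥0)
    (μ : T → ProbabilityMeasure (K → ℝ≥0)) : Prop :=
  ∃ ρ : ProbabilityMeasure (Utility K), ∀ t, ∀ E : Set (K → ℝ≥0), MeasurableSet E →
    (μ t : Measure (K → ℝ≥0)) E =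
      (ρ : Measure (Utility K)) {u | ∃ e ∈ E, IsOptimal u.1 (m t) (p t) e}

/-- The distribution `η` of the scale `λ > 0` and the common utility `u` generate the data. -/
def RPMGenerates {T K : Type*} [Fintype K] [DecidableEq K] (m : T → ℝ≥0) (p : T → K → ℝ≥0)
    (R : Finset K) (η : ProbabilityMeasure (Set.Ioi (0 : ℝ≥0))) (u : Utility K)
    (μ : T → ProbabilityMeasure (K → ℝ≥0)) : Prop :=
  ∀ t, ∀ E : Set (K → ℝ≥0), MeasurableSet E →
    (μ t : Measure (K → ℝ≥0)) E =
      (η : Measure (Set.Ioi (0 : ℝ≥0)))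
        {l | ∃ e ∈ E, IsOptimal u.1 (m t) (scalePrice R (l : ℝ≥0) (p t)) e}

/-- RPM-rationalizability with random scaling of the prices of the goods in `R`. -/
def RPMRationalizable {T K : Type*} [Fintype K] [DecidableEq K] (m : T → ℝ≥0) (p : T → K → ℝ≥0)
    (R : Finset K) (μ : T → ProbabilityMeasure (K → ℝ≥0)) : Prop :=
  ∃ (η : ProbabilityMeasure (Set.Ioi (0 : ℝ≥0))) (u : Utility K), RPMGenerates m p R η u μ

/-- RPM-rationalizability with consistency in expectation, `∫ λ dη(λ) = 1`. -/
def RPMRationalizableConsistent {T K : Type*} [Fintype K] [DecidableEq K] (m : T → ℝ≥0)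
    (p : T → K → ℝ≥0) (R : Finset K) (μ : T → ProbabilityMeasure (K → ℝ≥0)) : Prop :=
  ∃ (η : ProbabilityMeasure (Set.Ioi (0 : ℝ≥0))) (u : Utility K), RPMGenerates m p R η u μ ∧
    Integrable (fun l : Set.Ioi (0 : ℝ≥0) => ((l : ℝ≥0) : ℝ))
      (η : Measure (Set.Ioi (0 : ℝ≥0))) ∧
    ∫ l : Set.Ioi (0 : ℝ≥0), ((l : ℝ≥0) : ℝ) ∂(η : Measure (Set.Ioi (0 : ℝ≥0))) = 1

/-- A distribution on `ℝ^K_+` as a measure on Euclidean space `ℝ^K`. -/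
noncomputable def toEuclideanMeasure {K : Type*} [Fintype K]
    (μ : ProbabilityMeasure (K → ℝ≥0)) : Measure (EuclideanSpace ℝ K) :=
  (μ : Measure (K → ℝ≥0)).map fun e => WithLp.toLp 2 fun k => (e k : ℝ)

/-- The Lévy–Prokhorov distance for the Euclidean norm. -/
noncomputable def dLP {K : Type*} [Fintype K] (μ ν : ProbabilityMeasure (K → ℝ≥0)) : ℝ :=
  levyProkhorovDist (toEuclideanMeasure μ) (toEuclideanMeasure ν)

/-! Scaling the prices of the goods in `R` by `λ` is the same as keeping prices and replacing `u` by
`u(x_R / λ, x_{-R})`. So a random scale is a random utility, and part 1 is a push-forward, once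
demand is known to be measurable in the utility.

For parts 2 and 3, a random utility yields a random profile of demands, one allocation per
observation, each profile being generated by a single utility. The core is `exists_common_utility`:
countably many profiles `d i`, generated by `w i`, all arise from one `u` at scales `l i`. Take `u`
to be the infimum of the pieces `V i x = a i + w i (l i • x_R, x_{-R})`. At scale `l i`, `V i` has
maximizer `d i` on every budget, so `d i` maximizes `u` as soon as `V i` is the lowest piece at the
bundles of `d i`. Later pieces are higher there because the levels `a j` grow fast; earlier ones
because they see the `R`-part multiplied by `l j / l i`, which is made huge. The latter needs
positive spending on `R` and `w j` unbounded along the axes. An arbitrary utility may be bounded,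
but only finitely many observations matter, and an Afriat construction
(`exists_axisCoercive_isOptimal`) replaces it by an unbounded one.

The law of the profile then gives the law of the scale; since `l i ≤ 1` its mean is finite, and
rescaling `u` makes it one. Discrete data have countably many profiles. In general the demand
profile is approximated by simple functions whose values are still rational profiles. -/

open Filter Topology

/-! ### Price scaling as a change of utility -/

section Scaling

variable {K : Type*} [DecidableEq K]

/-- The bundle `(a x_R, x_{-R})`. -/
def scaleBundle (R : Finset K) (a : ℝ≥0) (x : K → ℝ≥0) : K → ℝ≥0 :=
  fun k => if k ∈ R then a * x k else x k

lemma bundle_scalePrice (R : Finset K) (l : ℝ≥0) (e p : K → ℝ≥0) :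
    bundle e (scalePrice R l p) = scaleBundle R l⁻¹ (bundle e p) := by
  funext k
  by_cases hk : k ∈ R
  · simp only [bundle, scalePrice, scaleBundle, hk, if_true, div_eq_mul_inv, mul_inv]
    ring
  · simp [bundle, scalePrice, scaleBundle, hk]

lemma scalePrice_pos {p : K → ℝ≥0} (hp : ∀ k, 0 < p k) (R : Finset K) {l : ℝ≥0} (hl : 0 < l)
    (k : K) : 0 < scalePrice R l p k := by
  by_cases hk : k ∈ R
  · simpa [scalePrice, hk] using ⟨hl, hp k⟩
  · simpa [scalePrice, hk] using hp k

lemma scaleBundle_scaleBundle (R : Finset K) (a b : ℝ≥0) (x : K → ℝ≥0) :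
    scaleBundle R a (scaleBundle R b x) = scaleBundle R (a * b) x := by
  funext k
  by_cases hk : k ∈ R <;> simp [scaleBundle, hk, mul_assoc]

lemma scaleBundle_one (R : Finset K) (x : K → ℝ≥0) : scaleBundle R 1 x = x := by
  funext k
  simp [scaleBundle]

lemma scaleBundle_mono_left (R : Finset K) {a b : ℝ≥0} (h : a ≤ b) (x : K → ℝ≥0) :
    scaleBundle R a x ≤ scaleBundle R b x := by
  intro k
  by_cases hk : k ∈ R
  · simp only [scaleBundle, hk, if_true]
    gcongr
  · simp [scaleBundle, hk]

lemma monotone_scaleBundle (R : Finset K) (a : ℝ≥0) : Monotone (scaleBundle R a) := by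
  intro x y h k
  have := h k
  by_cases hk : k ∈ R
  · simp only [scaleBundle, hk, if_true]
    gcongr
  · simpa [scaleBundle, hk] using this

lemma scaleBundle_injective (R : Finset K) {a : ℝ≥0} (ha : 0 < a) :
    Function.Injective (scaleBundle R a) := by
  intro x y h
  have := congrArg (scaleBundle R a⁻¹) h
  simpa [scaleBundle_scaleBundle, inv_mul_cancel₀ ha.ne', scaleBundle_one] using this

lemma continuous_scaleBundle (R : Finset K) :
    Continuous fun q : ℝ≥0 × (K → ℝ≥0) => scaleBundle R q.1 q.2 := by
  refine continuous_pi fun k => ?_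
  by_cases hk : k ∈ R
  · simp only [scaleBundle, hk, if_true]
    fun_prop
  · simp only [scaleBundle, hk, if_false]
    fun_prop

lemma scaleBundle_combo (R : Finset K) (a c d : ℝ≥0) (x y : K → ℝ≥0) :
    scaleBundle R a (c • x + d • y) = c • scaleBundle R a x + d • scaleBundle R a y := by
  funext k
  by_cases hk : k ∈ R
  · simp only [scaleBundle, hk, if_true, Pi.add_apply, Pi.smul_apply, smul_eq_mul]
    ring
  · simp [scaleBundle, hk]

lemma IsUtility.comp_scaleBundle {u : (K → ℝ≥0) → ℝ} (hu : IsUtility u) (R : Finset K) {a : ℝ≥0}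
    (ha : 0 < a) : IsUtility fun x => u (scaleBundle R a x) where
  strictMono := hu.strictMono.comp
    ((monotone_scaleBundle R a).strictMono_of_injective (scaleBundle_injective R ha))
  strictConcave := by
    refine ⟨convex_univ, fun x _ y _ hxy c d hc hd hcd => ?_⟩
    simp only [scaleBundle_combo]
    exact hu.strictConcave.2 (Set.mem_univ _) (Set.mem_univ _)
      ((scaleBundle_injective R ha).ne hxy) hc hd hcd
  continuous := hu.continuous.comp
    ((continuous_scaleBundle R).comp (by fun_prop : Continuous fun x : K → ℝ≥0 => (a, x)))

/-- The utility `x ↦ u (a x_R, x_{-R})`. -/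
noncomputable def Utility.scale (u : Utility K) (R : Finset K) (a : Set.Ioi (0 : ℝ≥0)) : Utility K :=
  ⟨fun x => u.1 (scaleBundle R (a : ℝ≥0)⁻¹ x), u.2.comp_scaleBundle R (inv_pos.2 a.2)⟩

lemma measurable_utility_scale (u : Utility K) (R : Finset K) : Measurable (u.scale R) := by
  refine Measurable.subtype_mk (measurable_pi_lambda _ fun x => ?_)
  have h1 : Continuous fun l : Set.Ioi (0 : ℝ≥0) => ((l : ℝ≥0)⁻¹, x) := by
    refine Continuous.prodMk ?_ continuous_const
    exact continuous_subtype_val.inv₀ fun l => l.2.ne'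
  exact (u.2.continuous.comp ((continuous_scaleBundle R).comp h1)).measurable

variable [Fintype K]

lemma isOptimal_utility_scale (u : Utility K) (R : Finset K) (a : Set.Ioi (0 : ℝ≥0)) (m : ℝ≥0)
    (p e : K → ℝ≥0) :
    IsOptimal (u.scale R a).1 m p e ↔ IsOptimal u.1 m (scalePrice R (a : ℝ≥0) p) e := by
  simp only [IsOptimal, Utility.scale, bundle_scalePrice]

end Scaling

/-! ### Measurability of demand; random scaling is a random utility -/

section Demand

variable {K : Type*}

lemma continuous_bundle (p : K → ℝ≥0) : Continuous fun e => bundle e p :=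
  continuous_pi fun k => (continuous_apply k).div_const _

lemma measurable_utility_apply (x : K → ℝ≥0) : Measurable fun u : Utility K => u.1 x :=
  (measurable_pi_apply x).comp measurable_subtype_coe

lemma measurableSet_utility_lt (x y : K → ℝ≥0) (c : ℝ) :
    MeasurableSet {u : Utility K | u.1 x < u.1 y + c} :=
  measurableSet_lt (measurable_utility_apply x) ((measurable_utility_apply y).add_const c)

variable [Fintype K]

lemma allocations_nonempty [Nonempty K] (m : ℝ≥0) :
    (allocations m : Set (K → ℝ≥0)).Nonempty := by
  classical
  exact ⟨Pi.single (Classical.arbitrary K) m, by simp [allocations]⟩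

/-- By compactness, the optimum lies in `F` iff the maximum over allocations in `F` reaches the
overall one. Continuity lets countable dense sets test this up to `1 / (n + 1)`, leaving countably
many conditions on evaluations. -/
lemma exists_isOptimal_iff_of_dense [Nonempty K] {m : ℝ≥0} {p : K → ℝ≥0} {F : Set (K → ℝ≥0)}
    (hF : IsClosed F) {D : Set (allocations m : Set (K → ℝ≥0))} (hD : Dense D)
    {D' : Set (allocations m ∩ F : Set (K → ℝ≥0))} (hD' : Dense D')
    (u : Utility K) :
    (∃ e ∈ F, IsOptimal u.1 m p e) ↔ ∀ d ∈ D, ∀ n : ℕ, ∃ d' ∈ D',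
      u.1 (bundle d.1 p) < u.1 (bundle d'.1 p) + 1 / ((n : ℝ) + 1) := by
  have hc : Continuous fun e => u.1 (bundle e p) := u.2.continuous.comp (continuous_bundle p)
  constructor
  · rintro ⟨e, heF, he, hopt⟩ d _ n
    have hopen : IsOpen {x : (allocations m ∩ F : Set (K → ℝ≥0)) |
        u.1 (bundle d.1 p) < u.1 (bundle x.1 p) + 1 / ((n : ℝ) + 1)} :=
      isOpen_lt continuous_const ((hc.comp continuous_subtype_val).add continuous_const)
    obtain ⟨x, hx, hxD⟩ := hD'.exists_mem_open hopen ⟨⟨e, he, heF⟩, by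
      have h1 := hopt d.1 d.2
      have h2 : (0 : ℝ) < 1 / ((n : ℝ) + 1) := by positivity
      rw [Set.mem_ofPred_eq]
      linarith⟩
    exact ⟨x, hx, hxD⟩
  · intro h
    have : Nonempty (allocations m : Set (K → ℝ≥0)) := (allocations_nonempty m).to_subtype
    obtain ⟨d₀, hd₀⟩ := hD.nonempty
    -- Used only to see that some allocation lies in `F`.
    obtain ⟨d₁, -, -⟩ := h d₀ hd₀ 0
    obtain ⟨e, he, hmax⟩ := ((isCompact_allocations m).inter_right hF).exists_isMaxOn
      ⟨d₁.1, d₁.2⟩ hc.continuousOn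
    refine ⟨e, he.2, he.1, fun e' he' => ?_⟩
    have hclosed : IsClosed {x : (allocations m : Set (K → ℝ≥0)) |
        u.1 (bundle x.1 p) ≤ u.1 (bundle e p)} :=
      isClosed_le (hc.comp continuous_subtype_val) continuous_const
    have hsub : D ⊆ {x | u.1 (bundle x.1 p) ≤ u.1 (bundle e p)} := by
      intro d hd
      rw [Set.mem_ofPred_eq]
      refine le_of_forall_pos_lt_add fun δ hδ => ?_
      obtain ⟨n, hn⟩ := exists_nat_one_div_lt hδ
      obtain ⟨d', -, hd'⟩ := h d hd n
      have := hmax d'.2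
      simp only [Set.mem_ofPred_eq] at this
      linarith
    have := hclosed.closure_subset_iff.2 hsub (hD ⟨e', he'⟩)
    exact this

/-- The optimal allocation. -/
noncomputable def demand [Nonempty K] (m : ℝ≥0) {p : K → ℝ≥0} (hp : ∀ k, 0 < p k)
    (u : Utility K) : K → ℝ≥0 :=
  (existsUnique_isOptimal u.2 m hp).choose

lemma isOptimal_iff_eq_demand [Nonempty K] {m : ℝ≥0} {p : K → ℝ≥0} (hp : ∀ k, 0 < p k)
    (u : Utility K) (e : K → ℝ≥0) : IsOptimal u.1 m p e ↔ e = demand m hp u :=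
  ⟨fun h => (existsUnique_isOptimal u.2 m hp).choose_spec.2 e h,
    fun h => h ▸ (existsUnique_isOptimal u.2 m hp).choose_spec.1⟩

lemma isOptimal_demand [Nonempty K] {m : ℝ≥0} {p : K → ℝ≥0} (hp : ∀ k, 0 < p k)
    (u : Utility K) : IsOptimal u.1 m p (demand m hp u) :=
  (isOptimal_iff_eq_demand hp u _).2 rfl

lemma setOf_exists_isOptimal [Nonempty K] {m : ℝ≥0} {p : K → ℝ≥0} (hp : ∀ k, 0 < p k)
    (E : Set (K → ℝ≥0)) :
    {u : Utility K | ∃ e ∈ E, IsOptimal u.1 m p e} = demand m hp ⁻¹' E := by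
  ext u
  simp [isOptimal_iff_eq_demand hp]

lemma measurable_demand [Nonempty K] (m : ℝ≥0) {p : K → ℝ≥0} (hp : ∀ k, 0 < p k) :
    Measurable (demand m hp) := by
  refine measurable_of_isClosed fun F hF => ?_
  obtain ⟨D, hDc, hD⟩ := TopologicalSpace.exists_countable_dense
    (allocations m : Set (K → ℝ≥0))
  obtain ⟨D', hDc', hD'⟩ := TopologicalSpace.exists_countable_dense
    (allocations m ∩ F : Set (K → ℝ≥0))
  rw [← setOf_exists_isOptimal hp]
  simp only [exists_isOptimal_iff_of_dense hF hD hD', Set.ofPred_forall, Set.ofPred_exists]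
  simp only [← exists_prop, Set.ofPred_exists]
  exact MeasurableSet.biInter hDc fun d _ => MeasurableSet.iInter fun n =>
    MeasurableSet.biUnion hDc' fun d' _ => measurableSet_utility_lt _ _ _

lemma measurableSet_exists_isOptimal [Nonempty K] (m : ℝ≥0) {p : K → ℝ≥0} (hp : ∀ k, 0 < p k)
    {E : Set (K → ℝ≥0)} (hE : MeasurableSet E) :
    MeasurableSet {u : Utility K | ∃ e ∈ E, IsOptimal u.1 m p e} := by
  rw [setOf_exists_isOptimal hp]
  exact measurable_demand m hp hE

variable [DecidableEq K]

lemma measurableSet_exists_isOptimal_scalePrice [Nonempty K] (u : Utility K) (R : Finset K)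
    (m : ℝ≥0) {p : K → ℝ≥0} (hp : ∀ k, 0 < p k) {E : Set (K → ℝ≥0)} (hE : MeasurableSet E) :
    MeasurableSet {l : Set.Ioi (0 : ℝ≥0) |
      ∃ e ∈ E, IsOptimal u.1 m (scalePrice R (l : ℝ≥0) p) e} := by
  have := measurable_utility_scale u R (measurableSet_exists_isOptimal m hp hE)
  simpa only [Set.preimage_ofPred_eq, isOptimal_utility_scale] using this

theorem RPMRationalizable.rumRationalizable {T : Type*} [Nonempty K] {m : T → ℝ≥0}
    {p : T → K → ℝ≥0} (hp : ∀ t k, 0 < p t k) {R : Finset K}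
    {μ : T → ProbabilityMeasure (K → ℝ≥0)} (h : RPMRationalizable m p R μ) :
    RUMRationalizable m p μ := by
  obtain ⟨η, u, hη⟩ := h
  have hmeas := measurable_utility_scale u R
  refine ⟨η.map hmeas.aemeasurable, fun t E hE => ?_⟩
  rw [hη t E hE, ProbabilityMeasure.toMeasure_map,
    Measure.map_apply hmeas (measurableSet_exists_isOptimal (m t) (hp t) hE)]
  simp only [Set.preimage_ofPred_eq, isOptimal_utility_scale]

end Demand

/-! ### Lower envelopes of utilities -/

section Infimum

lemma exists_forall_le_of_finset_minorant {X ι : Type*} {V : ι → X → ℝ} {x : X} {s : Finset ι}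
    (hs : s.Nonempty) (h : ∀ j, ∃ i ∈ s, V i x ≤ V j x) : ∃ i ∈ s, ∀ j, V i x ≤ V j x := by
  obtain ⟨i, hi, hmin⟩ := s.exists_min_image (fun i => V i x) hs
  exact ⟨i, hi, fun j => let ⟨i', hi', hle⟩ := h j; (hmin i' hi').trans hle⟩

lemma iInf_eq_of_forall_le {X ι : Type*} {V : ι → X → ℝ} {x : X} {i : ι}
    (h : ∀ j, V i x ≤ V j x) : ⨅ j, V j x = V i x := by
  have : Nonempty ι := ⟨i⟩
  exact le_antisymm (ciInf_le ⟨V i x, by rintro _ ⟨j, rfl⟩; exact h j⟩ i) (le_ciInf h)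

/-- An infimum of utility functions which locally is the minimum of finitely many of them is a
utility function. -/
lemma IsUtility.iInf {K ι : Type*} {V : ι → (K → ℝ≥0) → ℝ} (hV : ∀ i, IsUtility (V i))
    (hfin : ∀ x, ∃ s : Finset ι, s.Nonempty ∧ ∀ᶠ y in 𝓝 x, ∀ j, ∃ i ∈ s, V i y ≤ V j y) :
    IsUtility fun x => ⨅ i, V i x := by
  have hatt : ∀ x, ∃ i, ∀ j, V i x ≤ V j x := fun x => by
    obtain ⟨s, hs, h⟩ := hfin x
    obtain ⟨i, -, hi⟩ := exists_forall_le_of_finset_minorant hs h.self_of_nhds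
    exact ⟨i, hi⟩
  have hle : ∀ x i, ⨅ j, V j x ≤ V i x := fun x i => by
    obtain ⟨i₀, h⟩ := hatt x
    rw [iInf_eq_of_forall_le h]
    exact h i
  refine ⟨fun x y hxy => ?_, ⟨convex_univ, fun x _ y _ hxy a b ha hb hab => ?_⟩, ?_⟩
  -- A piece attaining the infimum at the larger point bounds the infimum at the smaller one.
  · obtain ⟨i, hi⟩ := hatt y
    show ⨅ j, V j x < ⨅ j, V j y
    rw [iInf_eq_of_forall_le hi]
    exact (hle x i).trans_lt ((hV i).strictMono hxy)
  · obtain ⟨i, hi⟩ := hatt (a • x + b • y)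
    show a • (⨅ j, V j x) + b • (⨅ j, V j y) < ⨅ j, V j (a • x + b • y)
    rw [iInf_eq_of_forall_le hi]
    refine lt_of_le_of_lt ?_
      ((hV i).strictConcave.2 (Set.mem_univ _) (Set.mem_univ _) hxy ha hb hab)
    simp only [NNReal.smul_def, smul_eq_mul]
    have := hle x i
    have := hle y i
    gcongr
  · refine continuous_iff_continuousAt.2 fun x => ?_
    obtain ⟨s, hs, h⟩ := hfin x
    have hcont : Continuous fun y => s.inf' hs fun i => V i y :=
      Continuous.finset_inf'_apply hs fun i _ => (hV i).continuous
    refine hcont.continuousAt.congr ?_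
    filter_upwards [h] with y hy
    obtain ⟨i, his, hi⟩ := exists_forall_le_of_finset_minorant hs hy
    rw [iInf_eq_of_forall_le hi]
    exact le_antisymm (Finset.inf'_le _ his) (Finset.le_inf' _ _ fun j _ => hi j)

end Infimum

/-! ### Strictly concave, nearly linear gains -/

/-- The strictly concave and strictly increasing perturbation `s - δ (e^{-s} - 1 + s)` of the
identity, for `0 < δ < 1`. -/
noncomputable def bentId (δ s : ℝ) : ℝ := s - δ * (Real.exp (-s) - 1 + s)

section BentId

lemma bentId_zero (δ : ℝ) : bentId δ 0 = 0 := by simp [bentId]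

lemma bentId_le {δ : ℝ} (hδ : 0 ≤ δ) (s : ℝ) : bentId δ s ≤ s := by
  have := mul_nonneg hδ (by linarith [Real.add_one_le_exp (-s)] : 0 ≤ Real.exp (-s) - 1 + s)
  unfold bentId
  linarith

lemma strictMono_bentId {δ : ℝ} (h0 : 0 < δ) (h1 : δ < 1) : StrictMono (bentId δ) := by
  intro s r h
  have h2 : Real.exp (-r) ≤ Real.exp (-s) := Real.exp_le_exp.2 (by linarith)
  unfold bentId
  nlinarith [mul_le_mul_of_nonneg_left h2 h0.le]

lemma strictConcaveOn_bentId {δ : ℝ} (h0 : 0 < δ) : StrictConcaveOn ℝ Set.univ (bentId δ) := by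
  refine ⟨convex_univ, fun s _ r _ hsr a b ha hb hab => ?_⟩
  have h := strictConvexOn_exp.2 (Set.mem_univ (-s)) (Set.mem_univ (-r)) (by simpa using hsr)
    ha hb hab
  simp only [smul_eq_mul] at h ⊢
  have h2 := mul_lt_mul_of_pos_left h h0
  have h3 : -(a * s + b * r) = a * -s + b * -r := by ring
  unfold bentId
  rw [h3]
  have h4 : a = 1 - b := by linarith
  subst h4
  nlinarith

lemma continuous_bentId (δ : ℝ) : Continuous (bentId δ) := by
  unfold bentId
  fun_prop

lemma tendsto_bentId {δ : ℝ} (h0 : 0 < δ) (h1 : δ < 1) : Tendsto (bentId δ) atTop atTop := by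
  refine tendsto_atTop_mono' atTop (f₁ := fun s => (1 - δ) * s) ?_
    (tendsto_id.const_mul_atTop (by linarith))
  filter_upwards [eventually_ge_atTop 0] with s hs
  have : Real.exp (-s) ≤ 1 := Real.exp_le_one_iff.2 (by linarith)
  unfold bentId
  nlinarith

end BentId

/-- The gain `∑ p_k ψ(x_k - y_k)` from `y` to `x` at prices `p`, with `ψ` close to the identity. -/
noncomputable def bentGain {K : Type*} [Fintype K] (δ : ℝ) (p y x : K → ℝ≥0) : ℝ :=
  ∑ k, (p k : ℝ) * bentId δ ((x k : ℝ) - y k)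

/-- `u` is unbounded along every coordinate axis. -/
def AxisCoercive {K : Type*} [DecidableEq K] (u : (K → ℝ≥0) → ℝ) : Prop :=
  ∀ k, Tendsto (fun s : ℝ≥0 => u (Pi.single k s)) atTop atTop

section BentGain

variable {K : Type*} [Fintype K]

lemma bentGain_self (δ : ℝ) (p y : K → ℝ≥0) : bentGain δ p y y = 0 := by
  simp [bentGain, bentId_zero]

/-- The bend lies below its tangent at zero, so no bundle costing at most as much as `y` has a
positive gain over `y`. -/
lemma bentGain_le {δ : ℝ} (hδ : 0 ≤ δ) (p y x : K → ℝ≥0) :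
    bentGain δ p y x ≤ (∑ k, (p k : ℝ) * x k) - ∑ k, (p k : ℝ) * y k := by
  rw [← Finset.sum_sub_distrib]
  refine Finset.sum_le_sum fun k _ => ?_
  rw [← mul_sub]
  exact mul_le_mul_of_nonneg_left (bentId_le hδ _) (p k).2

lemma isUtility_bentGain {δ : ℝ} (h0 : 0 < δ) (h1 : δ < 1) {p : K → ℝ≥0} (hp : ∀ k, 0 < p k)
    (y : K → ℝ≥0) {b : ℝ} (hb : 0 < b) (c : ℝ) :
    IsUtility fun x => c + b * bentGain δ p y x := by
  have hp' : ∀ k, (0 : ℝ) < p k := fun k => NNReal.coe_pos.2 (hp k)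
  refine ⟨fun x x' h => ?_, ⟨convex_univ, fun x _ x' _ hne a a' ha ha' haa => ?_⟩, ?_⟩
  · obtain ⟨hle, k, hk⟩ := Pi.lt_def.1 h
    have : bentGain δ p y x < bentGain δ p y x' := by
      refine Finset.sum_lt_sum (fun i _ => ?_) ⟨k, Finset.mem_univ k, ?_⟩
      · refine mul_le_mul_of_nonneg_left ((strictMono_bentId h0 h1).monotone ?_) (hp' i).le
        have : (x i : ℝ) ≤ x' i := NNReal.coe_le_coe.2 (hle i)
        linarith
      · refine mul_lt_mul_of_pos_left (strictMono_bentId h0 h1 ?_) (hp' k)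
        have : (x k : ℝ) < x' k := NNReal.coe_lt_coe.2 hk
        linarith
    show c + b * _ < c + b * _
    gcongr
  · have haa' : (a : ℝ) + a' = 1 := by exact_mod_cast haa
    have ha2 : (0 : ℝ) < a := NNReal.coe_pos.2 ha
    have ha2' : (0 : ℝ) < a' := NNReal.coe_pos.2 ha'
    obtain ⟨k, hk⟩ := Function.ne_iff.1 hne
    have key : ∀ i, ((a • x + a' • x') i : ℝ) - y i
        = a * ((x i : ℝ) - y i) + a' * ((x' i : ℝ) - y i) := fun i => by
      simp only [Pi.add_apply, Pi.smul_apply, smul_eq_mul, NNReal.coe_add, NNReal.coe_mul]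
      linear_combination (y i : ℝ) * haa'
    have : (a : ℝ) * bentGain δ p y x + a' * bentGain δ p y x'
        < bentGain δ p y (a • x + a' • x') := by
      simp only [bentGain, Finset.mul_sum, ← Finset.sum_add_distrib, key]
      refine Finset.sum_lt_sum (fun i _ => ?_) ⟨k, Finset.mem_univ k, ?_⟩
      · have := (strictConcaveOn_bentId h0).concaveOn.2 (Set.mem_univ ((x i : ℝ) - y i))
          (Set.mem_univ ((x' i : ℝ) - y i)) ha2.le ha2'.le haa'
        simp only [smul_eq_mul] at this
        nlinarith [mul_le_mul_of_nonneg_left this (hp' i).le]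
      · have := (strictConcaveOn_bentId h0).2 (Set.mem_univ ((x k : ℝ) - y k))
          (Set.mem_univ ((x' k : ℝ) - y k))
          (fun h => hk (NNReal.coe_injective (by linarith))) ha2 ha2' haa'
        simp only [smul_eq_mul] at this
        nlinarith [mul_lt_mul_of_pos_left this (hp' k)]
    simp only [NNReal.smul_def, smul_eq_mul]
    have h5 := mul_lt_mul_of_pos_left this hb
    have h6 : (a : ℝ) = 1 - a' := by linarith
    rw [h6] at h5 ⊢
    linarith
  · have := continuous_bentId δ
    unfold bentGain
    fun_prop

lemma axisCoercive_bentGain [DecidableEq K] {δ : ℝ} (h0 : 0 < δ) (h1 : δ < 1) {p : K → ℝ≥0}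
    (hp : ∀ k, 0 < p k) (y : K → ℝ≥0) {b : ℝ} (hb : 0 < b) (c : ℝ) :
    AxisCoercive fun x => c + b * bentGain δ p y x := by
  intro k
  refine tendsto_atTop_add_const_left _ _ (Tendsto.const_mul_atTop hb ?_)
  unfold bentGain
  simp only [← Finset.add_sum_erase _ _ (Finset.mem_univ k), Pi.single_eq_same]
  have hrest : ∀ s : ℝ≥0, ∑ i ∈ Finset.univ.erase k,
      (p i : ℝ) * bentId δ (((Pi.single k s : K → ℝ≥0) i : ℝ) - y i)
      = ∑ i ∈ Finset.univ.erase k, (p i : ℝ) * bentId δ (0 - y i) := fun s =>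
    Finset.sum_congr rfl fun i hi => by
      rw [Pi.single_eq_of_ne (Finset.ne_of_mem_erase hi)]
      simp
  simp only [hrest]
  refine tendsto_atTop_add_const_right _ _
    (Tendsto.const_mul_atTop (NNReal.coe_pos.2 (hp k)) ((tendsto_bentId h0 h1).comp ?_))
  exact tendsto_atTop_add_const_right _ (-(y k : ℝ)) (NNReal.tendsto_coe_atTop.2 tendsto_id)

/-- At `δ = 0` the gain is the cost difference; finitely many strict inequalities survive a small
`δ`. -/
lemma exists_bentGain_pos {ι : Type*} [Finite ι] (p y x : ι → K → ℝ≥0)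
    (h : ∀ i, ∑ k, (p i k : ℝ) * y i k < ∑ k, (p i k : ℝ) * x i k) :
    ∃ δ : ℝ, 0 < δ ∧ δ < 1 ∧ ∀ i, 0 < bentGain δ (p i) (y i) (x i) := by
  have h1 : ∀ᶠ δ in 𝓝[>] (0 : ℝ), ∀ i, 0 < bentGain δ (p i) (y i) (x i) := by
    refine eventually_all.2 fun i => ?_
    have hc : Continuous fun δ => bentGain δ (p i) (y i) (x i) := by
      unfold bentGain bentId
      fun_prop
    refine (hc.continuousAt.eventually (lt_mem_nhds ?_)).filter_mono nhdsWithin_le_nhds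
    have := h i
    simp only [bentGain, bentId, zero_mul, sub_zero, mul_sub, Finset.sum_sub_distrib]
    linarith
  obtain ⟨δ, ⟨hδ, h0⟩, hδ1⟩ := ((h1.and self_mem_nhdsWithin).and
    ((gt_mem_nhds one_pos).filter_mono nhdsWithin_le_nhds)).exists
  exact ⟨δ, h0, hδ1, hδ⟩

end BentGain

/-! ### Afriat's construction of an unbounded utility -/

/-- Afriat numbers: levels `φ` and slopes `β` that are compatible with the gains `g t s`. -/
lemma exists_afriat_numbers {T : Type*} [Finite T] (v : T → ℝ) (g : T → T → ℝ)
    (hg : ∀ t s, v t ≤ v s → 0 < g t s ∨ (g t s = 0 ∧ v s = v t)) :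
    ∃ φ β : T → ℝ, (∀ t, 0 < β t) ∧ ∀ t s, φ s ≤ φ t + β t * g t s := by
  have hC : ∀ᶠ C : ℝ in atTop, ∀ t s, 0 < g t s → 1 ≤ C * g t s := by
    refine eventually_all.2 fun t => eventually_all.2 fun s => ?_
    by_cases h : 0 < g t s
    · filter_upwards [(tendsto_id.atTop_mul_const h).eventually_ge_atTop 1] with C hC _
      exact hC
    · exact Eventually.of_forall fun C h' => absurd h' h
  obtain ⟨C, hC, hCpos⟩ := (hC.and (eventually_gt_atTop 0)).exists
  have hB : ∀ᶠ B : ℝ in atTop, ∀ t s, v s < v t → 1 + C * |g t s| ≤ Real.exp (B * (v t - v s)) := by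
    refine eventually_all.2 fun t => eventually_all.2 fun s => ?_
    by_cases h : v s < v t
    · filter_upwards [(Real.tendsto_exp_atTop.comp
        (tendsto_id.atTop_mul_const (sub_pos.2 h))).eventually_ge_atTop (1 + C * |g t s|)]
        with B hB _
      exact hB
    · exact Eventually.of_forall fun B h' => absurd h' h
  obtain ⟨B, hB⟩ := hB.exists
  -- After division by `exp (-B * v t)` the claim is `1 - C * g t s ≤ exp (B * (v t - v s))`. If `v
  -- t ≤ v s`, either `C * g t s ≥ 1` or both sides equal one; otherwise `B` is large enough.
  refine ⟨fun t => -Real.exp (-B * v t), fun t => C * Real.exp (-B * v t), fun t => by positivity,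
    fun t s => ?_⟩
  have hpt := Real.exp_pos (-B * v t)
  have hps := Real.exp_pos (-B * v s)
  rcases le_or_gt (v t) (v s) with h | h
  · rcases hg t s h with h' | ⟨h', hv⟩
    · nlinarith [hC t s h']
    · simp [h', hv]
  · have h1 : Real.exp (-B * v s) = Real.exp (-B * v t) * Real.exp (B * (v t - v s)) := by
      rw [← Real.exp_add]
      ring_nf
    have h2 := mul_le_mul_of_nonneg_left (hB t s h) hpt.le
    have h3 := mul_le_mul_of_nonneg_left (neg_abs_le (g t s))
      (mul_pos hCpos hpt).le
    show -Real.exp (-B * v s) ≤ _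
    rw [h1]
    linarith

section Rationalization

lemma mul_bundle {K : Type*} {p : K → ℝ≥0} (hp : ∀ k, 0 < p k) (e : K → ℝ≥0) (k : K) :
    p k * bundle e p k = e k := by
  simp [bundle, mul_div_cancel₀ _ (hp k).ne']

variable {K : Type*} [Fintype K]

lemma sum_mul_bundle {p : K → ℝ≥0} (hp : ∀ k, 0 < p k) {m : ℝ≥0} {e : K → ℝ≥0}
    (he : e ∈ allocations m) : ∑ k, (p k : ℝ) * bundle e p k = m := by
  have h : ∑ k, e k = m := he
  rw [← h]
  push_cast
  exact Finset.sum_congr rfl fun k _ => by rw [← NNReal.coe_mul, mul_bundle hp]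

/-- A bundle that is at least as good as the optimal one and differs from it is not affordable. -/
lemma IsOptimal.lt_sum_mul [Nonempty K] {u : (K → ℝ≥0) → ℝ} (hu : IsUtility u) {m : ℝ≥0}
    {p : K → ℝ≥0} (hp : ∀ k, 0 < p k) {e : K → ℝ≥0} (he : IsOptimal u m p e) {x : K → ℝ≥0}
    (hx : u (bundle e p) ≤ u x) (hne : x ≠ bundle e p) : (m : ℝ) < ∑ k, (p k : ℝ) * x k := by
  classical
  by_contra! hle
  have hle' : ∑ k, p k * x k ≤ m := by exact_mod_cast hle
  -- Leftover income goes to an arbitrary good, so the bundle of `e'` dominates `x`. Then `e'` is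
  -- optimal, hence equals `e`.
  set e' : K → ℝ≥0 := (fun k => p k * x k) +
    Pi.single (Classical.arbitrary K) (m - ∑ k, p k * x k) with he'
  have hmem : e' ∈ allocations m := by
    simp only [allocations, Set.mem_ofPred_eq, he', Pi.add_apply, Finset.sum_add_distrib,
      Finset.sum_pi_single', Finset.mem_univ, if_true]
    exact add_tsub_cancel_of_le hle'
  have hxe : x ≤ bundle e' p := fun k => by
    rw [bundle, le_div_iff₀ (hp k), mul_comm]
    exact le_self_add
  have hopt : IsOptimal u m p e' := ⟨hmem, fun e'' h'' =>
    (he.2 e'' h'').trans (hx.trans (hu.strictMono.monotone hxe))⟩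
  have heq := (existsUnique_isOptimal hu m hp).unique hopt he
  rw [heq] at hxe
  exact absurd (hu.strictMono (lt_of_le_of_ne hxe hne)) (not_lt.2 hx)

/-- Finitely many observations that are optimal for some utility are optimal for one that is
unbounded along the coordinate axes. -/
theorem exists_axisCoercive_isOptimal [Nonempty K] [DecidableEq K] {T : Type*} [Finite T]
    [Nonempty T] {u : (K → ℝ≥0) → ℝ} (hu : IsUtility u) (m : T → ℝ≥0) {p : T → K → ℝ≥0}
    (hp : ∀ t k, 0 < p t k) {d : T → K → ℝ≥0} (hd : ∀ t, IsOptimal u (m t) (p t) (d t)) :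
    ∃ w, IsUtility w ∧ AxisCoercive w ∧ ∀ t, IsOptimal w (m t) (p t) (d t) := by
  cases nonempty_fintype T
  set x : T → K → ℝ≥0 := fun t => bundle (d t) (p t) with hx
  have hbudget : ∀ t, ∑ k, (p t k : ℝ) * x t k = m t := fun t => sum_mul_bundle (hp t) (hd t).1
  -- Revealed preference: a chosen bundle weakly preferred to `x t` and different from it costs more
  -- than `m t`.
  obtain ⟨δ, h0, h1, hpos⟩ := exists_bentGain_pos
    (ι := {q : T × T // u (x q.1) ≤ u (x q.2) ∧ x q.2 ≠ x q.1})
    (fun q => p q.1.1) (fun q => x q.1.1) (fun q => x q.1.2) fun q => by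
      rw [hbudget]
      exact (hd q.1.1).lt_sum_mul hu (hp _) q.2.1 q.2.2
  obtain ⟨φ, β, hβ, hφ⟩ := exists_afriat_numbers (fun t => u (x t))
    (fun t s => bentGain δ (p t) (x t) (x s)) fun t s hts => by
      by_cases hne : x s = x t
      · right
        simp [hne, bentGain_self]
      · exact Or.inl (hpos ⟨(t, s), hts, hne⟩)
  set V : T → (K → ℝ≥0) → ℝ := fun t z => φ t + β t * bentGain δ (p t) (x t) z with hV
  have hbdd : ∀ z, BddBelow (Set.range fun t => V t z) := fun z => (Set.finite_range _).bddBelow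
  refine ⟨fun z => ⨅ t, V t z, IsUtility.iInf
    (fun t => isUtility_bentGain h0 h1 (hp t) (x t) (hβ t) (φ t))
    fun z => ⟨Finset.univ, Finset.univ_nonempty,
      Eventually.of_forall fun y j => ⟨j, Finset.mem_univ j, le_rfl⟩⟩, fun k => ?_,
    fun t => ⟨(hd t).1, fun e' he' => ?_⟩⟩
  · refine tendsto_atTop.2 fun M => ?_
    have := eventually_all.2 fun t => tendsto_atTop.1
      (axisCoercive_bentGain h0 h1 (hp t) (x t) (hβ t) (φ t) k) M
    filter_upwards [this] with s hs
    exact le_ciInf hs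
  -- Every affordable bundle has `V t` at most `φ t`, while the Afriat inequalities put all pieces
  -- at `x t` above `φ t`.
  · have hle : V t (bundle e' (p t)) ≤ φ t := by
      have h2 := bentGain_le h0.le (p t) (x t) (bundle e' (p t))
      rw [hbudget, sum_mul_bundle (hp t) he', sub_self] at h2
      have := mul_nonpos_of_nonneg_of_nonpos (hβ t).le h2
      simp only [hV]
      linarith
    exact ((ciInf_le (hbdd _) t).trans hle).trans (le_ciInf fun s => hφ s t)

end Rationalization

/-! ### One utility for countably many profiles -/

/-- Levels which make the shifted utilities `a i + w i` increase in `i` on bounded sets, and exceed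
at the origin the values of all earlier ones at given points. -/
lemma exists_levels {K T : Type*} [Finite T] {w : ℕ → (K → ℝ≥0) → ℝ} (hw : ∀ i, Monotone (w i)) (x : ℕ → T → K → ℝ≥0) :
    ∃ a : ℕ → ℝ, (∀ i : ℕ, a 0 + w 0 (fun _ => (i : ℝ≥0)) ≤ a i + w i 0 ∨ i = 0) ∧
      ∀ i j, j < i → ∀ t, a j + w j (x j t) ≤ a i + w i 0 := by
  cases nonempty_fintype T
  set h : ℕ → ℝ := fun j => |w j 0| + ∑ t, |w j (x j t)| with hh
  have h0 : ∀ j, 0 ≤ h j := fun j => by positivity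
  have hz : ∀ j, -w j 0 ≤ h j ∧ w j 0 ≤ h j := fun j => by
    have h1 : 0 ≤ ∑ t, |w j (x j t)| := by positivity
    have h2 := neg_abs_le (w j 0)
    have h3 := le_abs_self (w j 0)
    constructor <;> simp only [hh] <;> linarith
  have hx : ∀ j t, w j (x j t) ≤ h j := fun j t => by
    have h1 := Finset.single_le_sum (f := fun t => |w j (x j t)|) (fun _ _ => abs_nonneg _)
      (Finset.mem_univ t)
    have h2 := le_abs_self (w j (x j t))
    have h3 := abs_nonneg (w j 0)
    simp only [hh]
    linarith
  have hsum : ∀ i j, j < i → ∑ n ∈ Finset.range j, h n + h j ≤ ∑ n ∈ Finset.range i, h n :=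
    fun i j hji => by
      rw [← Finset.sum_range_succ]
      exact Finset.sum_le_sum_of_subset_of_nonneg (Finset.range_mono hji) fun n _ _ => h0 n
  have hconst : ∀ i j : ℕ, j ≤ i → w 0 (fun _ => (j : ℝ≥0)) ≤ w 0 (fun _ => (i : ℝ≥0)) :=
    fun i j hji => hw 0 fun _ => by exact_mod_cast hji
  -- `h j` dominates `-w j 0`, `w j 0` and all `w j (x j t)`. It is counted twice: once for the term
  -- in `a j`, once for `w j (x j t)`. The last summand dominates piece `0` on the cube of side `i`.
  refine ⟨fun i => 2 * ∑ n ∈ Finset.range i, h n + h i + w 0 (fun _ => (i : ℝ≥0)),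
    fun i => ?_, fun i j hji t => ?_⟩
  · rcases Nat.eq_zero_or_pos i with hi | hi
    · exact Or.inr hi
    · left
      have h1 := hsum i 0 hi
      have h2 := hz 0
      have h3 := hz i
      have h4 : w 0 (fun _ => ((0 : ℕ) : ℝ≥0)) = w 0 0 := by
        congr 1
        funext k
        simp
      simp only [Finset.range_zero, Finset.sum_empty] at h1 ⊢
      rw [h4]
      linarith
  · have h1 := hsum i j hji
    have h2 := hx j t
    have h3 := hz i
    have h4 := hconst i j hji.le
    linarith

/-- Decreasing scales `l i ≤ 1` whose consecutive ratios exceed given thresholds. -/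
lemma exists_scales (P : ℕ → ℝ≥0 → Prop) (hP : ∀ i, ∀ᶠ r in atTop, P i r) :
    ∃ l : ℕ → ℝ≥0, (∀ i, 0 < l i ∧ l i ≤ 1) ∧ ∀ i j, j < i → P i (l j / l i) := by
  choose M hM using fun i => eventually_atTop.1 ((hP i).and (eventually_ge_atTop 1))
  -- With `l = 1 / L`, the ratio `l j / l i = L i / L j` contains the factor `max 1 (M i)` whenever
  -- `j < i`.
  set L : ℕ → ℝ≥0 := fun i => ∏ j ∈ Finset.range (i + 1), max 1 (M j) with hL
  have hsucc : ∀ i, L (i + 1) = L i * max 1 (M (i + 1)) := fun i => Finset.prod_range_succ _ _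
  have hmono : Monotone L := monotone_nat_of_le_succ fun i => by
    rw [hsucc]
    exact le_mul_of_one_le_right' (le_max_left _ _)
  have h1 : ∀ i, 1 ≤ L i := fun i => Finset.one_le_prod'' fun j => le_max_left _ _
  have hpos : ∀ i, 0 < L i := fun i => one_pos.trans_le (h1 i)
  refine ⟨fun i => (L i)⁻¹, fun i => ⟨inv_pos.2 (hpos i), inv_le_one_of_one_le₀ (h1 i)⟩,
    fun i j hji => (hM i _ ?_).1⟩
  obtain ⟨i, rfl⟩ : ∃ i', i = i' + 1 := ⟨i - 1, by omega⟩
  rw [inv_div_inv, le_div_iff₀ (hpos j), hsucc, mul_comm]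
  exact mul_le_mul' (hmono (by omega)) (le_max_right _ _)

section CommonUtility

variable {K : Type*} [DecidableEq K]

/-- The scaled bundle dominates its projection to the axis of a consumed good in `R`. -/
lemma AxisCoercive.tendsto_scaleBundle {w : (K → ℝ≥0) → ℝ} (hco : AxisCoercive w)
    (hw : Monotone w) {R : Finset K} {x : K → ℝ≥0} (hx : ∃ k ∈ R, 0 < x k) :
    Tendsto (fun r => w (scaleBundle R r x)) atTop atTop := by
  obtain ⟨k, hk, hxk⟩ := hx
  refine tendsto_atTop_mono (fun r => hw ?_)
    ((hco k).comp (tendsto_id.atTop_mul_const hxk : Tendsto (fun r : ℝ≥0 => r * x k) atTop atTop))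
  intro i
  by_cases hi : i = k
  · subst hi
    simp [scaleBundle, hk]
  · simp [Pi.single_eq_of_ne hi]

variable {T : Type*} [Finite T] [Fintype K]

/-- Countably many profiles, each consisting of optimal allocations for one of the utilities `w i`,
are optimal for a single utility after scaling the prices of the goods in `R`. -/
theorem exists_common_utility (m : T → ℝ≥0) {p : T → K → ℝ≥0} (hp : ∀ t k, 0 < p t k)
    (R : Finset K) {w : ℕ → (K → ℝ≥0) → ℝ} (hw : ∀ i, IsUtility (w i))
    (hco : ∀ i, AxisCoercive (w i)) {d : ℕ → T → K → ℝ≥0}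
    (hd : ∀ i t, IsOptimal (w i) (m t) (p t) (d i t)) (hpos : ∀ i t, ∃ k ∈ R, 0 < d i t k) :
    ∃ l : ℕ → ℝ≥0, (∀ i, 0 < l i ∧ l i ≤ 1) ∧ ∃ u : Utility K,
      ∀ i t, IsOptimal u.1 (m t) (scalePrice R (l i) (p t)) (d i t) := by
  have hmono : ∀ i, Monotone (w i) := fun i => (hw i).strictMono.monotone
  set x : ℕ → T → K → ℝ≥0 := fun i t => bundle (d i t) (p t) with hx
  have hxpos : ∀ i t, ∃ k ∈ R, 0 < x i t k := fun i t => by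
    obtain ⟨k, hk, h⟩ := hpos i t
    exact ⟨k, hk, div_pos h (hp t k)⟩
  obtain ⟨a, ha, ha'⟩ := exists_levels hmono x
  obtain ⟨l, hl, hl'⟩ := exists_scales
    (fun i r => ∀ j ∈ Finset.range i, ∀ t,
      a i + w i (x i t) ≤ a j + w j (scaleBundle R r (x i t))) fun i => by
    refine (Finset.eventually_all _).2 fun j _ => eventually_all.2 fun t => ?_
    exact (tendsto_atTop_add_const_left _ (a j)
      ((hco j).tendsto_scaleBundle (hmono j) (hxpos i t))).eventually_ge_atTop _
  set V : ℕ → (K → ℝ≥0) → ℝ := fun i y => a i + w i (scaleBundle R (l i) y) with hV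
  have hVU : ∀ i, IsUtility (V i) := fun i => by
    have h := (hw i).comp_scaleBundle R (hl i).1
    exact ⟨fun y z hyz => add_lt_add_right (h.strictMono hyz) _,
      (concaveOn_const (a i) convex_univ).add_strictConcaveOn h.strictConcave,
      continuous_const.add h.continuous⟩
  have hV0 : ∀ i y, a i + w i 0 ≤ V i y := fun i y => by
    have := hmono i (zero_le : (0 : K → ℝ≥0) ≤ scaleBundle R (l i) y)
    simp only [hV]
    linarith
  have hVl : ∀ i e t, V i (bundle e (scalePrice R (l i) (p t))) = a i + w i (bundle e (p t)) :=
    fun i e t => by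
      simp only [hV, bundle_scalePrice, scaleBundle_scaleBundle, mul_inv_cancel₀ (hl i).1.ne',
        scaleBundle_one]
  -- On a cube of side `N`, each piece `j > N` exceeds piece `0`, already by its value at the
  -- origin; `l 0 ≤ 1` keeps the scaled bundle in the cube.
  have hfin : ∀ y : K → ℝ≥0, ∃ s : Finset ℕ, s.Nonempty ∧
      ∀ᶠ z in 𝓝 y, ∀ j, ∃ i ∈ s, V i z ≤ V j z := fun y => by
    obtain ⟨N, hN⟩ : ∃ N : ℕ, ∀ k, y k < N := by
      obtain ⟨N, hN⟩ := exists_nat_gt (∑ k, y k)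
      exact ⟨N, fun k => (Finset.single_le_sum (fun _ _ => zero_le) (Finset.mem_univ k)).trans_lt
        hN⟩
    refine ⟨Finset.range (N + 1), ⟨0, by simp⟩, ?_⟩
    have hev : ∀ᶠ z in 𝓝 y, ∀ k, z k < (N : ℝ≥0) :=
      eventually_all.2 fun k => (continuous_apply k).continuousAt.eventually (gt_mem_nhds (hN k))
    filter_upwards [hev] with z hz j
    by_cases hj : j < N + 1
    · exact ⟨j, by simpa using hj, le_rfl⟩
    · refine ⟨0, by simp, le_trans ?_ (hV0 j z)⟩
      refine le_trans ?_ ((ha j).resolve_right (by omega))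
      have h1 : scaleBundle R (l 0) z ≤ fun _ => (j : ℝ≥0) := by
        refine (scaleBundle_mono_left R (hl 0).2 z).trans ?_
        rw [scaleBundle_one]
        intro k
        have : (N : ℝ≥0) ≤ j := by exact_mod_cast (by omega : N ≤ j)
        exact (hz k).le.trans this
      have := hmono 0 h1
      simp only [hV]
      linarith
  refine ⟨l, hl, ⟨fun y => ⨅ i, V i y, IsUtility.iInf hVU hfin⟩, fun i t => ⟨(hd i t).1, ?_⟩⟩
  intro e' he'
  have hmin : ∀ j, V i (bundle (d i t) (scalePrice R (l i) (p t)))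
      ≤ V j (bundle (d i t) (scalePrice R (l i) (p t))) := fun j => by
    rw [hVl]
    rcases lt_trichotomy j i with h | h | h
    · have := hl' i j h j (Finset.mem_range.2 h) t
      simp only [hV, bundle_scalePrice, scaleBundle_scaleBundle]
      rwa [div_eq_mul_inv] at this
    · subst h
      exact (hVl j _ t).ge
    · exact (ha' j i h t).trans (hV0 j _)
  have hbdd : BddBelow (Set.range fun j => V j (bundle e' (scalePrice R (l i) (p t)))) := by
    obtain ⟨s, hs, h⟩ := hfin (bundle e' (scalePrice R (l i) (p t)))
    obtain ⟨j, -, hj⟩ := exists_forall_le_of_finset_minorant hs h.self_of_nhds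
    exact ⟨_, by rintro _ ⟨j', rfl⟩; exact hj j'⟩
  -- The envelope is below `V i` everywhere and equals it at the bundle of `d i t`, which maximizes
  -- `V i` on the budget.
  refine (ciInf_le hbdd i).trans (le_trans ?_ (le_ciInf hmin))
  rw [hVl, hVl]
  exact add_le_add_right ((hd i t).2 e' he') _

end CommonUtility

/-! ### Lévy–Prokhorov distance of coupled variables -/

section LevyProkhorov

variable {Ω : Type*} [MeasurableSpace Ω] {P : Measure Ω} [IsProbabilityMeasure P]

/-- Off an event of probability at most `δ`, `X ∈ B` forces `Y` into each `ε`-thickening of `B` with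
`ε > δ`. -/
lemma levyProkhorovDist_map_le {E : Type*} [PseudoMetricSpace E] [MeasurableSpace E]
    [OpensMeasurableSpace E] {X Y : Ω → E} (hX : Measurable X) (hY : Measurable Y) {δ : ℝ}
    (hδ : 0 ≤ δ) (h : P {ω | δ ≤ dist (Y ω) (X ω)} ≤ ENNReal.ofReal δ) :
    levyProkhorovDist (P.map X) (P.map Y) ≤ δ := by
  have := Measure.isProbabilityMeasure_map (μ := P) hX.aemeasurable
  have := Measure.isProbabilityMeasure_map (μ := P) hY.aemeasurable
  refine levyProkhorovDist_le_of_forall_le _ _ hδ fun ε B hε hB => ?_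
  rw [Measure.map_apply hX hB, Measure.map_apply hY Metric.isOpen_thickening.measurableSet]
  have hsub : X ⁻¹' B ⊆ Y ⁻¹' Metric.thickening ε B ∪ {ω | δ ≤ dist (Y ω) (X ω)} := fun ω hω => by
    rcases le_or_gt δ (dist (Y ω) (X ω)) with h' | h'
    · exact Or.inr h'
    · exact Or.inl (Metric.mem_thickening_iff.2 ⟨X ω, hω, h'.trans hε⟩)
  calc P (X ⁻¹' B) ≤ P (Y ⁻¹' Metric.thickening ε B) + P {ω | δ ≤ dist (Y ω) (X ω)} :=
        (measure_mono hsub).trans (measure_union_le _ _)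
    _ ≤ _ := by
        gcongr
        exact h.trans (ENNReal.ofReal_le_ofReal hε.le)

lemma eventually_levyProkhorovDist_map_lt {E : Type*} [PseudoMetricSpace E]
    [SecondCountableTopology E] [MeasurableSpace E] [BorelSpace E] {X : Ω → E} {Y : ℕ → Ω → E}
    (hX : Measurable X) (hY : ∀ n, Measurable (Y n))
    (hlim : ∀ᵐ ω ∂P, Tendsto (fun n => Y n ω) atTop (𝓝 (X ω))) {ε : ℝ} (hε : 0 < ε) :
    ∀ᶠ n in atTop, levyProkhorovDist (P.map X) (P.map (Y n)) < ε := by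
  have h1 := tendstoInMeasure_iff_dist.1 (tendstoInMeasure_of_tendsto_ae_of_measurable_edist
    (fun n => (hY n).edist hX) hlim) (ε / 2) (by positivity)
  filter_upwards [h1.eventually (ge_mem_nhds (ENNReal.ofReal_pos.2 (half_pos hε)))] with n hn
  exact (levyProkhorovDist_map_le hX (hY n) (half_pos hε).le hn).trans_lt (half_lt_self hε)

lemma eventually_dLP_lt {K : Type*} [Fintype K] {X : Ω → K → ℝ≥0} {Y : ℕ → Ω → K → ℝ≥0}
    (hX : Measurable X) (hY : ∀ n, Measurable (Y n))
    (hlim : ∀ᵐ ω ∂P, Tendsto (fun n => Y n ω) atTop (𝓝 (X ω)))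
    {μ : ProbabilityMeasure (K → ℝ≥0)} {ν : ℕ → ProbabilityMeasure (K → ℝ≥0)}
    (hμ : (μ : Measure (K → ℝ≥0)) = P.map X)
    (hν : ∀ n, (ν n : Measure (K → ℝ≥0)) = P.map (Y n)) {ε : ℝ} (hε : 0 < ε) :
    ∀ᶠ n in atTop, dLP μ (ν n) < ε := by
  have hc : Continuous fun e : K → ℝ≥0 => (WithLp.toLp 2 fun k => (e k : ℝ) :
      EuclideanSpace ℝ K) :=
    (PiLp.continuous_toLp 2 _).comp (by fun_prop)
  have := eventually_levyProkhorovDist_map_lt (P := P) (hc.measurable.comp hX)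
    (fun n => hc.measurable.comp (hY n))
    (hlim.mono fun ω h => (hc.tendsto _).comp h) hε
  filter_upwards [this] with n hn
  rwa [dLP, toEuclideanMeasure, toEuclideanMeasure, hμ, hν, Measure.map_map hc.measurable hX,
    Measure.map_map hc.measurable (hY n)]

end LevyProkhorov

/-! ### From countably many profiles to a scale of mean one -/

section RandomScaling

/-- A profile of allocations that a single utility generates, with positive expenditure on the goods
in `R` at every observation. -/
def IsRationalProfile {T K : Type*} [Fintype K] (m : T → ℝ≥0) (p : T → K → ℝ≥0) (R : Finset K) (d : T → K → ℝ≥0) : Prop :=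
  (∃ u : Utility K, ∀ t, IsOptimal u.1 (m t) (p t) (d t)) ∧ ∀ t, ∃ k ∈ R, 0 < d t k

variable {T K : Type*} [Finite T] [Fintype K] [DecidableEq K]

lemma exists_common_utility_of_countable [Nonempty T] [Nonempty K] (m : T → ℝ≥0)
    {p : T → K → ℝ≥0} (hp : ∀ t k, 0 < p t k) (R : Finset K) {C : Set (T → K → ℝ≥0)}
    (hC : C.Countable) (hne : C.Nonempty) (hgood : ∀ d ∈ C, IsRationalProfile m p R d) :
    ∃ l : C → ℝ≥0, (∀ c, 0 < l c ∧ l c ≤ 1) ∧ ∃ u : Utility K,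
      ∀ c t, IsOptimal u.1 (m t) (scalePrice R (l c) (p t)) (c.1 t) := by
  have := hne.to_subtype
  have := hC.to_subtype
  obtain ⟨f, hf⟩ := exists_surjective_nat C
  choose v hv using fun i => (hgood (f i).1 (f i).2).1
  choose w hw hco hopt using fun i => exists_axisCoercive_isOptimal (v i).2 m hp (hv i)
  obtain ⟨l, hl, u, hu⟩ := exists_common_utility m hp R hw hco hopt
    fun i => (hgood (f i).1 (f i).2).2
  -- The enumeration may repeat a profile; a right inverse selects one scale for it.
  refine ⟨fun c => l (Function.surjInv hf c), fun c => hl _, u, fun c t => ?_⟩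
  have := hu (Function.surjInv hf c) t
  rwa [Function.surjInv_eq hf] at this

/-- The law of a random rational profile with countably many values is generated by random scaling
with mean one. -/
theorem rpmRationalizableConsistent_of_countable [Nonempty T] [Nonempty K] {Ω : Type*}
    [MeasurableSpace Ω] {P : Measure Ω} [IsProbabilityMeasure P] {m : T → ℝ≥0}
    {p : T → K → ℝ≥0} (hp : ∀ t k, 0 < p t k) {R : Finset K} {D : Ω → T → K → ℝ≥0}
    (hD : Measurable D) {C : Set (T → K → ℝ≥0)} (hC : C.Countable) (hDC : ∀ᵐ ω ∂P, D ω ∈ C)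
    (hgood : ∀ d ∈ C, IsRationalProfile m p R d) {μ : T → ProbabilityMeasure (K → ℝ≥0)}
    (hμ : ∀ t, (μ t : Measure (K → ℝ≥0)) = P.map fun ω => D ω t) :
    RPMRationalizableConsistent m p R μ := by
  cases nonempty_fintype T
  obtain ⟨ω₀, hω₀⟩ := hDC.exists
  obtain ⟨l, hl, u, hu⟩ := exists_common_utility_of_countable m hp R hC ⟨_, hω₀⟩ hgood
  have hCm : MeasurableSet C := hC.measurableSet
  have := hC.to_subtype
  set ν : Measure C := (P.map D).comap Subtype.val with hν
  have hνapply : ∀ s : Set C, ν s = P.map D (Subtype.val '' s) :=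
    comap_subtype_coe_apply hCm (P.map D)
  have hP1 : P.map D C = 1 := by
    rw [Measure.map_apply hD hCm]
    exact (mem_ae_iff_prob_eq_one (hD hCm)).1 hDC
  have : IsProbabilityMeasure ν := ⟨by rw [hνapply, Set.image_univ, Subtype.range_coe, hP1]⟩
  have hint : Integrable (fun c => (l c : ℝ)) ν :=
    Integrable.of_bound (measurable_of_countable _).aestronglyMeasurable 1
      (Eventually.of_forall fun c => by
        rw [Real.norm_of_nonneg (NNReal.coe_nonneg _)]
        exact_mod_cast (hl c).2)
  have hmean : 0 < ∫ c, (l c : ℝ) ∂ν := by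
    rw [integral_pos_iff_support_of_nonneg (fun c => NNReal.coe_nonneg _) hint]
    have : Function.support (fun c => (l c : ℝ)) = Set.univ :=
      Set.eq_univ_of_forall fun c => NNReal.coe_ne_zero.2 (hl c).1.ne'
    rw [this, measure_univ]
    exact one_pos
  -- Dividing the scales by their mean `a` normalizes them; `u.scale` by `a` compensates, leaving
  -- choices unchanged.
  set a : ℝ≥0 := ⟨∫ c, (l c : ℝ) ∂ν, hmean.le⟩ with ha
  have hapos : 0 < a := NNReal.coe_pos.1 hmean
  set L : C → Set.Ioi (0 : ℝ≥0) := fun c => ⟨l c / a, div_pos (hl c).1 hapos⟩ with hL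
  have hLm : Measurable L := measurable_of_countable _
  set η : ProbabilityMeasure (Set.Ioi (0 : ℝ≥0)) :=
    ⟨ν.map L, Measure.isProbabilityMeasure_map hLm.aemeasurable⟩ with hη
  have hopt : ∀ c t, IsOptimal (u.scale R ⟨a, hapos⟩).1 (m t)
      (scalePrice R (L c : ℝ≥0) (p t)) (c.1 t) := fun c t => by
    rw [isOptimal_utility_scale]
    have h1 : scalePrice R a (scalePrice R (L c : ℝ≥0) (p t)) = scalePrice R (l c) (p t) := by
      funext k
      by_cases hk : k ∈ R
      · simp only [scalePrice, hk, if_true, hL]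
        rw [← mul_assoc, mul_div_cancel₀ _ hapos.ne']
      · simp [scalePrice, hk]
    rw [h1]
    exact hu c t
  have hmap : ∫ x : Set.Ioi (0 : ℝ≥0), ((x : ℝ≥0) : ℝ) ∂(ν.map L) = 1 := by
    rw [integral_map hLm.aemeasurable (by fun_prop)]
    simp only [hL, NNReal.coe_div, integral_div]
    exact div_self hmean.ne'
  refine ⟨η, u.scale R ⟨a, hapos⟩, fun t E hE => ?_, ?_, hmap⟩
  · show _ = ν.map L _
    rw [Measure.map_apply hLm (measurableSet_exists_isOptimal_scalePrice _ R (m t) (hp t) hE),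
      hνapply, hμ, Measure.map_apply (by fun_prop) hE]
    have hset : (Subtype.val '' (L ⁻¹' {x : Set.Ioi (0 : ℝ≥0) | ∃ e ∈ E,
        IsOptimal (u.scale R ⟨a, hapos⟩).1 (m t) (scalePrice R (x : ℝ≥0) (p t)) e}) :
        Set (T → K → ℝ≥0)) = {d | d t ∈ E} ∩ C := by
      ext d
      constructor
      · rintro ⟨c, ⟨e, he, hce⟩, rfl⟩
        have := (existsUnique_isOptimal (u.scale R ⟨a, hapos⟩).2 (m t)
          (scalePrice_pos (hp t) R (L c).2)).unique hce (hopt c t)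
        rw [this] at he
        exact ⟨he, c.2⟩
      · rintro ⟨hd, hdC⟩
        exact ⟨⟨d, hdC⟩, ⟨d t, hd, hopt ⟨d, hdC⟩ t⟩, rfl⟩
    have hm : MeasurableSet {d : T → K → ℝ≥0 | d t ∈ E} := measurable_pi_apply t hE
    rw [hset, Measure.map_apply hD (hm.inter hCm)]
    refine measure_congr ?_
    filter_upwards [hDC] with ω hω
    exact propext ⟨fun h => ⟨h, hω⟩, fun h => h.1⟩
  -- A non-integrable function has integral zero by convention, and this integral is one.
  · refine Integrable.of_integral_ne_zero (μ := ν.map L) ?_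
    rw [hmap]
    exact one_ne_zero

end RandomScaling

/-! ### Random demand profiles: the discrete case and finite approximation -/

section DemandProfile

variable {T K : Type*} [Fintype K]

/-- The profile of optimal allocations of a utility. -/
noncomputable def demandProfile [Nonempty K] (m : T → ℝ≥0) {p : T → K → ℝ≥0}
    (hp : ∀ t k, 0 < p t k) (u : Utility K) : T → K → ℝ≥0 :=
  fun t => demand (m t) (hp t) u

lemma measurable_demandProfile [Nonempty K] (m : T → ℝ≥0) {p : T → K → ℝ≥0}
    (hp : ∀ t k, 0 < p t k) : Measurable (demandProfile m hp) :=
  measurable_pi_lambda _ fun t => measurable_demand (m t) (hp t)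

/-- Couples all the `μ t` as marginals of one random profile. -/
lemma RUMRationalizable.exists_map_demandProfile [Nonempty K] {m : T → ℝ≥0} {p : T → K → ℝ≥0}
    (hp : ∀ t k, 0 < p t k) {μ : T → ProbabilityMeasure (K → ℝ≥0)}
    (h : RUMRationalizable m p μ) : ∃ ρ : ProbabilityMeasure (Utility K), ∀ t,
      (μ t : Measure (K → ℝ≥0)) = (ρ : Measure (Utility K)).map fun u => demandProfile m hp u t := by
  obtain ⟨ρ, hρ⟩ := h
  refine ⟨ρ, fun t => Measure.ext fun E hE => ?_⟩
  rw [hρ t E hE, setOf_exists_isOptimal (hp t)]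
  exact (Measure.map_apply (measurable_demand (m t) (hp t)) hE).symm

lemma measurableSet_allocations_pos (m : ℝ≥0) (R : Finset K) :
    MeasurableSet {e : K → ℝ≥0 | e ∈ allocations m ∧ ∃ k ∈ R, 0 < e k} := by
  refine (isCompact_allocations m).measurableSet.inter (?_ : MeasurableSet {e : K → ℝ≥0 | ∃ k ∈ R, 0 < e k})
  have : {e : K → ℝ≥0 | ∃ k ∈ R, 0 < e k} = ⋃ k ∈ R, {e | 0 < e k} := by
    ext e
    simp
  rw [this]
  exact R.measurableSet_biUnion fun k _ => measurableSet_lt measurable_const (measurable_pi_apply k)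

variable [Finite T] [Nonempty K] {m : T → ℝ≥0} {p : T → K → ℝ≥0}
  {R : Finset K} {μ : T → ProbabilityMeasure (K → ℝ≥0)}

lemma ae_isRationalProfile (hp : ∀ t k, 0 < p t k) {ρ : ProbabilityMeasure (Utility K)}
    (hR : ∀ t, (μ t : Measure (K → ℝ≥0)) {e | e ∈ allocations (m t) ∧ ∃ k ∈ R, 0 < e k} = 1)
    (hρ : ∀ t, (μ t : Measure (K → ℝ≥0)) =
      (ρ : Measure (Utility K)).map fun u => demandProfile m hp u t) :
    ∀ᵐ u ∂(ρ : Measure (Utility K)), IsRationalProfile m p R (demandProfile m hp u) := by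
  have h : ∀ᵐ u ∂(ρ : Measure (Utility K)), ∀ t, ∃ k ∈ R, 0 < demandProfile m hp u t k := by
    refine ae_all_iff.2 fun t => ?_
    have h1 := (mem_ae_iff_prob_eq_one (measurableSet_allocations_pos (m t) R)).2 (hR t)
    rw [hρ] at h1
    have h2 := ae_of_ae_map ((measurable_pi_apply t).comp
      (measurable_demandProfile m hp)).aemeasurable h1
    exact h2.mono fun u hu => hu.2
  filter_upwards [h] with u hu
  exact ⟨⟨u, fun t => isOptimal_demand (hp t) u⟩, hu⟩

variable [Nonempty T] [DecidableEq K]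

theorem RUMRationalizable.rpmRationalizableConsistent_of_countable (hp : ∀ t k, 0 < p t k)
    (hR : ∀ t, (μ t : Measure (K → ℝ≥0)) {e | e ∈ allocations (m t) ∧ ∃ k ∈ R, 0 < e k} = 1)
    (hdisc : ∀ t, ∃ S : Set (K → ℝ≥0), S.Countable ∧ (μ t : Measure (K → ℝ≥0)) S = 1)
    (h : RUMRationalizable m p μ) : RPMRationalizableConsistent m p R μ := by
  obtain ⟨ρ, hρ⟩ := h.exists_map_demandProfile hp
  choose S hS hS1 using hdisc
  refine _root_.rpmRationalizableConsistent_of_countable hp (measurable_demandProfile m hp)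
    -- A product of finitely many countable sets is countable, so the intersection is measurable
    -- whatever the set of rational profiles is.
    (C := Set.univ.pi S ∩ {d | IsRationalProfile m p R d})
    ((Set.countable_univ_pi hS).mono Set.inter_subset_left) ?_ (fun d hd => hd.2) hρ
  have h1 : ∀ᵐ u ∂(ρ : Measure (Utility K)), ∀ t, demandProfile m hp u t ∈ S t := by
    refine ae_all_iff.2 fun t => ?_
    have h2 := (mem_ae_iff_prob_eq_one (hS t).measurableSet).2 (hS1 t)
    rw [hρ] at h2
    exact ae_of_ae_map ((measurable_pi_apply t).comp
      (measurable_demandProfile m hp)).aemeasurable h2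
  filter_upwards [h1, ae_isRationalProfile hp hR hρ] with u hu hu'
  exact ⟨fun t _ => hu t, hu'⟩

theorem RUMRationalizable.exists_finite_approximation (hp : ∀ t k, 0 < p t k)
    (hR : ∀ t, (μ t : Measure (K → ℝ≥0)) {e | e ∈ allocations (m t) ∧ ∃ k ∈ R, 0 < e k} = 1)
    (h : RUMRationalizable m p μ) {ε : ℝ} (hε : 0 < ε) :
    ∃ μ' : T → ProbabilityMeasure (K → ℝ≥0),
      (∀ t, (μ' t : Measure (K → ℝ≥0)) (allocations (m t)) = 1) ∧
      (∀ t, ∃ S : Set (K → ℝ≥0), S.Finite ∧ (μ' t : Measure (K → ℝ≥0)) S = 1) ∧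
      (∀ t, dLP (μ t) (μ' t) < ε) ∧ RPMRationalizableConsistent m p R μ' := by
  cases nonempty_fintype T
  obtain ⟨ρ, hρ⟩ := h.exists_map_demandProfile hp
  have hae := ae_isRationalProfile hp hR hρ
  obtain ⟨u₀, hu₀⟩ := hae.exists
  set G : Set (T → K → ℝ≥0) := {d | IsRationalProfile m p R d} with hG
  have hD := measurable_demandProfile m hp
  -- The values stay in `G`, so every approximating profile is still generated by one utility; `G`
  -- need not be measurable.
  set A : ℕ → SimpleFunc (Utility K) (T → K → ℝ≥0) :=
    SimpleFunc.approxOn (demandProfile m hp) hD G (demandProfile m hp u₀) hu₀ with hA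
  have hAG : ∀ n u, A n u ∈ G := fun n u => SimpleFunc.approxOn_mem hD hu₀ n u
  have hAm : ∀ n t, Measurable fun u => A n u t := fun n t =>
    (measurable_pi_apply t).comp (A n).measurable
  have hlim : ∀ᵐ u ∂(ρ : Measure (Utility K)),
      Tendsto (fun n => A n u) atTop (𝓝 (demandProfile m hp u)) :=
    hae.mono fun u hu => SimpleFunc.tendsto_approxOn hD hu₀ (subset_closure hu)
  have hev : ∀ᶠ n in atTop, ∀ t, dLP (μ t) (ρ.map (hAm n t).aemeasurable) < ε :=
    eventually_all.2 fun t => eventually_dLP_lt ((measurable_pi_apply t).comp hD)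
      (fun n => hAm n t) (hlim.mono fun u hu => ((continuous_apply t).tendsto _).comp hu) (hρ t)
      (fun n => rfl) hε
  obtain ⟨n, hn⟩ := hev.exists
  refine ⟨fun t => ρ.map (hAm n t).aemeasurable, fun t => ?_, fun t => ?_, hn, ?_⟩
  · rw [ProbabilityMeasure.toMeasure_map,
      Measure.map_apply (hAm n t) (isCompact_allocations (m t)).measurableSet]
    have : (fun u => A n u t) ⁻¹' allocations (m t) = Set.univ :=
      Set.eq_univ_of_forall fun u => by
        obtain ⟨⟨v, hv⟩, -⟩ := hAG n u
        exact (hv t).1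
    rw [this, measure_univ]
  · have hfin := (A n).finite_range.image fun d => d t
    refine ⟨_, hfin, ?_⟩
    rw [ProbabilityMeasure.toMeasure_map, Measure.map_apply (hAm n t) hfin.measurableSet]
    have : (fun u => A n u t) ⁻¹' ((fun d => d t) '' Set.range (A n)) = Set.univ :=
      Set.eq_univ_of_forall fun u => ⟨A n u, ⟨u, rfl⟩, rfl⟩
    rw [this, measure_univ]
  · refine _root_.rpmRationalizableConsistent_of_countable (P := (ρ : Measure (Utility K))) hp
      (A n).measurable (A n).finite_range.countable (Eventually.of_forall fun u => ⟨u, rfl⟩) ?_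
      fun t => rfl
    rintro _ ⟨u, rfl⟩
    exact hAG n u

end DemandProfile

/-! ### No observations, and the conclusion -/

lemma rpmRationalizableConsistent_of_isEmpty {T K : Type*} [IsEmpty T] [Fintype K] [DecidableEq K]
    (m : T → ℝ≥0) (p : T → K → ℝ≥0) (R : Finset K) (μ : T → ProbabilityMeasure (K → ℝ≥0))
    (u : Utility K) : RPMRationalizableConsistent m p R μ := by
  refine ⟨⟨Measure.dirac ⟨1, zero_lt_one' ℝ≥0⟩, inferInstance⟩, u, fun t => isEmptyElim t, ?_, ?_⟩
  · exact integrable_dirac (by simp)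
  · show ∫ l, _ ∂(Measure.dirac _) = _
    rw [integral_dirac]
    simp

theorem proposition8 {T K : Type*} [Finite T] [Fintype K] [DecidableEq K]
    (m : T → ℝ≥0) (p : T → K → ℝ≥0) (hp : ∀ t k, 0 < p t k)
    (R : Finset K) (μ : T → ProbabilityMeasure (K → ℝ≥0))
    (hR : ∀ t, (μ t : Measure (K → ℝ≥0)) {e | e ∈ allocations (m t) ∧ ∃ k ∈ R, 0 < e k} = 1) :
    (RPMRationalizable m p R μ → RUMRationalizable m p μ) ∧
    (RUMRationalizable m p μ → ∀ ε : ℝ, 0 < ε →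
      ∃ μ' : T → ProbabilityMeasure (K → ℝ≥0),
        (∀ t, (μ' t : Measure (K → ℝ≥0)) (allocations (m t)) = 1) ∧
        (∀ t, ∃ S : Set (K → ℝ≥0), S.Finite ∧ (μ' t : Measure (K → ℝ≥0)) S = 1) ∧
        (∀ t, dLP (μ t) (μ' t) < ε) ∧
        RPMRationalizableConsistent m p R μ') ∧
    ((∀ t, ∃ S : Set (K → ℝ≥0), S.Countable ∧ (μ t : Measure (K → ℝ≥0)) S = 1) →
      RUMRationalizable m p μ → RPMRationalizableConsistent m p R μ) := by
  rcases isEmpty_or_nonempty T with hT | ⟨⟨t₀⟩⟩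
  -- Without observations only the existence of some utility is at stake, and a probability measure
  -- lives on a nonempty space.
  · have key : RUMRationalizable m p μ → ∀ μ' : T → ProbabilityMeasure (K → ℝ≥0),
        RPMRationalizableConsistent m p R μ' := fun ⟨ρ, _⟩ μ' =>
      rpmRationalizableConsistent_of_isEmpty m p R μ' ρ.nonempty.some
    exact ⟨fun ⟨_, u, _⟩ => ⟨⟨Measure.dirac u, inferInstance⟩, fun t => isEmptyElim t⟩,
      fun h ε _ => ⟨μ, fun t => isEmptyElim t, fun t => isEmptyElim t, fun t => isEmptyElim t,
        key h μ⟩, fun _ h => key h μ⟩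
  · have : Nonempty T := ⟨t₀⟩
    have : Nonempty K := by
      have h : {e | e ∈ allocations (m t₀) ∧ ∃ k ∈ R, 0 < e k}.Nonempty :=
        nonempty_of_measure_ne_zero (by rw [hR t₀]; exact one_ne_zero)
      obtain ⟨_, _, k, _⟩ := h
      exact ⟨k⟩
    exact ⟨fun h => h.rumRationalizable hp, fun h ε hε => RUMRationalizable.exists_finite_approximation hp hR h hε,
      fun hdisc h => RUMRationalizable.rpmRationalizableConsistent_of_countable hp hR hdisc h⟩
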